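/- **Conventions.** $\|\cdot\|$ is the Euclidean norm and $\|\theta\|_K^2=\theta^\top K\theta$. A function $a:[0,\infty)\to[0,\infty)$ is of class $\mathcal K$ if it is continuous, strictly increasing and $a(0)=0$; it is of class $\mathcal K_\infty$ if moreover $a(s)\to\infty$ as $s\to\infty$. A function $\beta:[0,\infty)^2\to[0,\infty)$ is of class $\mathcal{KL}$ if $\beta(\cdot,t)\in\mathcal K$ for all $t\ge 0$ and, for every $s>0$, $\beta(s,\cdot)$ is continuous, strictly decreasing and tends to $0$ at infinity. **Plant.** Let $x_{t+1}=f(x_t,u_t)$, $y_t=g(x_t,u_t)$, $t\in\mathbb N$, with $x_t\in\mathbb R^n$, $u_t,y_t\in\mathbb R^m$ and $f,g$ Lipschitz. Assume that for each $u$ there is exactly one $x=\pi(u)$ with $f(x,u)=x$, that $\pi$ is Lipschitz, and that each $\pi(u)$ is an input-to-state stable (ISS) equilibrium: there are $\beta\in\mathcal{KL}$ and $\gamma\in\mathcal K$ (which may depend on $u$) such that for every bounded $(d_t)$ every solution of $x_{t+1}=f(x_t,u+d_t)$ satisfies $\|x_t-\pi(u)\|\le\beta(\|x_0-\pi(u)\|,t)+\gamma(\sup_s\|d_s\|)$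 for all $t$. Assume that for each constant input $u_t=\bar r$ and each initial state, $y_t\to\bar r$. **Cost.** Let $J:\mathbb R^m\to\mathbb R$, and let $(\bar y^\star,\bar r^\star,\bar x^\star)$ minimise $J(\bar y)$ over all $(\bar y,\bar u,\bar x)$ with $\bar x=f(\bar x,\bar u)$, $\bar y=g(\bar x,\bar u)$. Assume that $J\in C^2$, that $\underline H\preceq\nabla^2J(y)\preceq\bar H$ for all $y$, and that there are $\kappa_1,\kappa_2,\kappa_3\in\mathcal K_\infty$ with $\kappa_1(\|y-\bar y^\star\|)\le J(y)\le\kappa_2(\|y-\bar y^\star\|)$ and $\|\nabla J(y)\|\ge\kappa_3(\|y-\bar y^\star\|)$ for all $y$. **Controller.** Let $\underline\alpha>0$ and let $K=K^\top\succ0$ satisfy $K-K(\bar H+\gamma I)K\succeq0$ for some scalar $\gamma$. The controller, with dither $d_t\in\mathbb R^m$, is $$u_t=r_t+d_t,\qquad r_{t+1}=\begin{cases}r_t-\alpha_tK\hat\theta_t&\text{if }\alpha_t\ge\underline\alpha,\\ r_t&\text{otherwise,}\end{cases}$$ where $\hat\theta_t\in\mathbb R^m$ are arbitrary gradient estimates,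 $\tilde\Theta_t\subseteq\mathbb R^m$ are arbitrary sets of estimation errors, and $$\alpha_t=\max\Big\{0,\,1-\sup_{\tilde\theta\in\tilde\Theta_t}\frac{\tilde\theta^\top K\hat\theta_t}{\|\hat\theta_t\|_K^2}\Big\}$$ (with $\alpha_t=0$ if $\hat\theta_t=0$ or the supremum is $+\infty$, and, by convention, also if $\tilde\Theta_t=\emptyset$). Write $\tilde x_t=x_t-\pi(r_t)$, $\tilde r_t=r_t-\bar r^\star$ and $V_r(\tilde r)=J(\tilde r+\bar r^\star)-J(\bar r^\star)$. **Claim (exploration mode, $\alpha_t=0$).** 1. The plant is ISS with respect to the dither. For each $\bar r\in\mathbb R^m$: - there are a continuous $V_x:\mathbb R^n\to\mathbb R$, functions $\underline p,\bar p,q\in\mathcal K_\infty$ and $\sigma\in\mathcal K$ with $\underline p(\|z\|)\le V_x(z)\le\bar p(\|z\|)$ for all $z\in\mathbb R^n$, such that along every closed-loop trajectory and for every $t$ with $r_t=\bar r$ and $\alpha_t=0$, $$\Delta V_x=V_x(\tilde x_{t+1})-V_x(\tilde x_t)\le-q(\|\tilde x_t\|)+\sigma(\|d_t\|);$$ - there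 are $\beta\in\mathcal{KL}$ and $\rho\in\mathcal K$ such that every closed-loop trajectory with $r_0=\bar r$ and bounded dither satisfies $\|\tilde x_t\|\le\beta(\|\tilde x_0\|,t)+\rho(\sup_s\|d_s\|)$ for every $t$ such that $\alpha_s=0$ for all $s<t$. 2. The controller is stable: there are $\kappa,\kappa'\in\mathcal K_\infty$ with $\kappa(\|z\|)\le V_r(z)\le\kappa'(\|z\|)$ for all $z\in\mathbb R^m$, and along every closed-loop trajectory, for every $t$ with $\alpha_t=0$, $\Delta V_r=V_r(\tilde r_{t+1})-V_r(\tilde r_t)=0$. -/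

import Mathlib

open Filter Topology Set

noncomputable section

/-- `ℝⁿ` with the Euclidean norm. -/
abbrev Vec (n : ℕ) : Type := EuclideanSpace ℝ (Fin n)

/-! ### Comparison functions (functions on `[0, ∞)`, represented by functions on `ℝ`) -/

/-- Class `𝒦`: continuous and strictly increasing on `[0, ∞)`, zero at zero. -/
structure IsClassK (a : ℝ → ℝ) : Prop where
  cont : ContinuousOn a (Ici 0)
  strictMono : StrictMonoOn a (Ici 0)
  map_zero : a 0 = 0

/-- Class `𝒦_∞`: class `𝒦` and unbounded. -/
structure IsClassKInf (a : ℝ → ℝ) : Prop extends IsClassK a where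
  tendsto : Tendsto a atTop atTop

/-- Class `𝒦ℒ`: class `𝒦` in the first argument; continuous, strictly decreasing and
convergent to zero in the second one. -/
structure IsClassKL (b : ℝ → ℝ → ℝ) : Prop where
  classK : ∀ t, 0 ≤ t → IsClassK (fun s => b s t)
  cont : ∀ s, 0 < s → ContinuousOn (b s) (Ici 0)
  strictAnti : ∀ s, 0 < s → StrictAntiOn (b s) (Ici 0)
  tendsto : ∀ s, 0 < s → Tendsto (b s) atTop (𝓝 0)

/-! ### The plant `x_{t+1} = f (x_t, u_t)`, `y_t = g (x_t, u_t)` -/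

/-- `x` is the state trajectory of the plant under the input sequence `u`. -/
def IsPlantTrajectory {n m : ℕ} (f : Vec n → Vec m → Vec n) (u : ℕ → Vec m)
    (x : ℕ → Vec n) : Prop :=
  ∀ t, x (t + 1) = f (x t) (u t)

/-- The equilibrium `xbar` for the constant input `ubar` is input-to-state stable with respect
to perturbations `d` of the input, `u_t = ubar + d_t`. -/
def IsISSEquilibrium {n m : ℕ} (f : Vec n → Vec m → Vec n) (xbar : Vec n) (ubar : Vec m) : Prop :=
  ∃ (β : ℝ → ℝ → ℝ) (γ : ℝ → ℝ), IsClassKL β ∧ IsClassK γ ∧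
    ∀ (d : ℕ → Vec m) (x : ℕ → Vec n), BddAbove (range fun s => ‖d s‖) →
      IsPlantTrajectory f (fun t => ubar + d t) x →
      ∀ t : ℕ, ‖x t - xbar‖ ≤ β ‖x 0 - xbar‖ t + γ (⨆ s, ‖d s‖)

/-- Assumptions on the plant: it is Lipschitz, every constant input `u` has a unique equilibrium
state `π u`, which is input-to-state stable, `π` is Lipschitz, and the output tracks constant
inputs. -/
structure PlantAssumption {n m : ℕ} (f : Vec n → Vec m → Vec n) (g : Vec n → Vec m → Vec m)
    (π : Vec m → Vec n) : Prop where
  lipschitz_f : ∃ L, LipschitzWith L (fun p : Vec n × Vec m => f p.1 p.2)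
  lipschitz_g : ∃ L, LipschitzWith L (fun p : Vec n × Vec m => g p.1 p.2)
  lipschitz_π : ∃ L, LipschitzWith L π
  equilibrium : ∀ u x, f x u = x ↔ x = π u
  iss : ∀ u, IsISSEquilibrium f (π u) u
  tracking : ∀ (r : Vec m) (x : ℕ → Vec n), IsPlantTrajectory f (fun _ => r) x →
    Tendsto (fun t => g (x t) r) atTop (𝓝 r)

/-- `(y, u, x)` minimises the cost `J y` over all equilibria `x = f (x, u)`, `y = g (x, u)`. -/
structure IsOptimalEquilibrium {n m : ℕ} (f : Vec n → Vec m → Vec n) (g : Vec n → Vec m → Vec m)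
    (J : Vec m → ℝ) (y u : Vec m) (x : Vec n) : Prop where
  state : x = f x u
  output : y = g x u
  minimal : ∀ (y' u' : Vec m) (x' : Vec n), x' = f x' u' → y' = g x' u' → J y ≤ J y'

/-! ### The cost -/

/-- The Hessian matrix `∇²J (y)`. -/
def hessian {m : ℕ} (J : Vec m → ℝ) (y : Vec m) : Matrix (Fin m) (Fin m) ℝ :=
  Matrix.of fun i j =>
    fderiv ℝ (fderiv ℝ J) y (EuclideanSpace.single i 1) (EuclideanSpace.single j 1)

/-- Assumptions on the cost `J`: it is `C²` with curvature between the matrices `Hlow` and `Hbar`,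
it is bounded by class `𝒦_∞` functions of `‖y - ystar‖`, and so is its gradient from below. -/
structure CostAssumption {m : ℕ} (J : Vec m → ℝ) (Hlow Hbar : Matrix (Fin m) (Fin m) ℝ)
    (ystar : Vec m) : Prop where
  contDiff : ContDiff ℝ 2 J
  curvature_lower : ∀ y, (hessian J y - Hlow).PosSemidef
  curvature_upper : ∀ y, (Hbar - hessian J y).PosSemidef
  cost_bounds : ∃ κ₁ κ₂ : ℝ → ℝ, IsClassKInf κ₁ ∧ IsClassKInf κ₂ ∧
    ∀ y, κ₁ ‖y - ystar‖ ≤ J y ∧ J y ≤ κ₂ ‖y - ystar‖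
  gradient_bound : ∃ κ₃ : ℝ → ℝ, IsClassKInf κ₃ ∧ ∀ y, κ₃ ‖y - ystar‖ ≤ ‖gradient J y‖

/-! ### The controller -/

/-- The controller gain `K` is symmetric positive definite and satisfies
`K - K (Hbar + γ I) K ⪰ 0`. -/
structure GainCondition {m : ℕ} (K Hbar : Matrix (Fin m) (Fin m) ℝ) (γ : ℝ) : Prop where
  posDef : K.PosDef
  ineq : (K - K * (Hbar + γ • (1 : Matrix (Fin m) (Fin m) ℝ)) * K).PosSemidef

open Classical in
/-- The adaptive step-size
`max {0, 1 - max_{θ ∈ Θ} (θᵀ K θhat) / ‖θhat‖_K²}` for the gradient estimate `θhat` and the set `Θ`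
of possible estimation errors; it is `0` when `θhat = 0`. The maximum over `Θ` is taken as a
supremum in the extended reals, so that the step-size is `0` if the supremum is `+∞`. -/
def stepSize {m : ℕ} (K : Matrix (Fin m) (Fin m) ℝ) (θhat : Vec m) (Θ : Set (Vec m)) : ℝ :=
  if θhat = 0 then 0
  else
    (max 0 (1 - ⨆ θ ∈ Θ,
      ((inner ℝ θ (K.toEuclideanLin θhat) / inner ℝ θhat (K.toEuclideanLin θhat) : ℝ) : EReal)
        )).toReal

/-- One step of the controller: `r ↦ r - α K θhat` if `α ≥ αmin`, and `r ↦ r` otherwise. -/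
def controllerStep {m : ℕ} (K : Matrix (Fin m) (Fin m) ℝ) (αmin α : ℝ) (θhat r : Vec m) : Vec m :=
  r + if αmin ≤ α then -(α • K.toEuclideanLin θhat) else 0

/-- `(x, r)` is a trajectory of the plant in closed loop with the controller, under the dither `d`,
the gradient estimates `θhat` and the sets `Θ` of estimation errors. The input is
`u_t = r_t + d_t`. -/
structure IsClosedLoop {n m : ℕ} (f : Vec n → Vec m → Vec n) (K : Matrix (Fin m) (Fin m) ℝ)
    (αmin : ℝ) (x : ℕ → Vec n) (r d θhat : ℕ → Vec m) (Θ : ℕ → Set (Vec m)) : Prop where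
  plant : IsPlantTrajectory f (fun t => r t + d t) x
  controller : ∀ t, r (t + 1) = controllerStep K αmin (stepSize K (θhat t) (Θ t)) (θhat t) (r t)

/-- The controller Lyapunov function `V_r (rtilde) = J (rtilde + rstar) - J (rstar)`. -/
def controllerLyapunov {m : ℕ} (J : Vec m → ℝ) (rstar rtilde : Vec m) : ℝ :=
  J (rtilde + rstar) - J rstar

end

/-! A zero step-size misses the threshold `αmin > 0`, so the reference is frozen and the dither is
the only input perturbation that the plant sees. The trajectory form is then the assumed ISS
estimate, and `V_r` is trivially constant. Tracking forces `ystar = rstar` and the cost bounds force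
`J ystar = 0`, so the bounds on `V_r` are the cost bounds.

The substance is the Lyapunov form, a converse ISS theorem (`exists_iss_lyapunov`). ISS provides a
gain margin (`iss_exists_gain_margin`): under inputs with `g ‖d‖ ≤ ‖x‖` the origin stays uniformly
stable and attractive. Writing such inputs as `d = g⁻¹(‖x‖) u` with `‖u‖ ≤ 1` gives a system with
compactly many disturbance values. For it (`exists_strict_lyapunov`) the worst-case value of `∑ α
‖x_t‖` along trajectories is a continuous strict Lyapunov function, once `α` is flat enough at zero
for the sums to converge. Inputs beyond the margin dominate the state, and the Lipschitz bound on
`f` lets `σ` absorb them. -/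

/-! ### Comparison functions -/

theorem IsClassK.nonneg {a : ℝ → ℝ} (ha : IsClassK a) {s : ℝ} (hs : 0 ≤ s) : 0 ≤ a s := by
  rw [← ha.map_zero]
  exact ha.strictMono.monotoneOn (mem_Ici.2 le_rfl) hs hs

theorem IsClassK.mono {a : ℝ → ℝ} (ha : IsClassK a) {s t : ℝ} (hs : 0 ≤ s) (hst : s ≤ t) :
    a s ≤ a t :=
  ha.strictMono.monotoneOn hs (hs.trans hst) hst

theorem IsClassK.comp {a b : ℝ → ℝ} (ha : IsClassK a) (hb : IsClassK b) :
    IsClassK (fun s => a (b s)) where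
  cont := ha.cont.comp hb.cont fun _ hs => hb.nonneg hs
  strictMono := fun _ hs _ ht hst => ha.strictMono (hb.nonneg hs) (hb.nonneg ht)
    (hb.strictMono hs ht hst)
  map_zero := by rw [hb.map_zero, ha.map_zero]

theorem IsClassKInf.comp {a b : ℝ → ℝ} (ha : IsClassKInf a) (hb : IsClassKInf b) :
    IsClassKInf (fun s => a (b s)) where
  toIsClassK := ha.toIsClassK.comp hb.toIsClassK
  tendsto := ha.tendsto.comp hb.tendsto

theorem IsClassK.add_id {a : ℝ → ℝ} (ha : IsClassK a) : IsClassKInf (fun s => a s + s) where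
  cont := ha.cont.add continuousOn_id
  strictMono := fun _ hs _ ht hst => add_lt_add (ha.strictMono hs ht hst) hst
  map_zero := by simp [ha.map_zero]
  tendsto := tendsto_atTop_mono' _ (by
    filter_upwards [eventually_ge_atTop 0] with s hs
    exact le_add_of_nonneg_left (ha.nonneg hs)) tendsto_id

theorem isClassKInf_const_mul {c : ℝ} (hc : 0 < c) : IsClassKInf (fun s => c * s) where
  cont := by fun_prop
  strictMono := fun _ _ _ _ hst => mul_lt_mul_of_pos_left hst hc
  map_zero := mul_zero c
  tendsto := tendsto_id.const_mul_atTop hc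

/-- A class `𝒦_∞` function has a continuous inverse. -/
theorem IsClassKInf.exists_inverse {a : ℝ → ℝ} (ha : IsClassKInf a) :
    ∃ b : ℝ → ℝ, Continuous b ∧ Monotone b ∧ (∀ s, 0 ≤ s → 0 ≤ b s ∧ a (b s) = s) ∧
      ∀ s, 0 ≤ s → b (a s) = s := by
  -- Extending by the identity to the negative axis makes `e` an order isomorphism of `ℝ`, whose
  -- inverse is automatically continuous.
  set e : ℝ → ℝ := fun s => if s ≤ 0 then s else a s with he
  have hpos : ∀ s, 0 ≤ s → e s = a s := fun s hs => by
    rcases hs.eq_or_lt with rfl | hs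
    · simp [he, ha.map_zero]
    · simp [he, not_le.2 hs]
  have hneg : ∀ s, s ≤ 0 → e s = s := fun s hs => by simp [he, hs]
  have hmono : StrictMono e := by
    intro s t hst
    rcases le_total 0 s with hs | hs
    · rw [hpos s hs, hpos t (hs.trans hst.le)]
      exact ha.strictMono hs (hs.trans hst.le) hst
    · rw [hneg s hs]
      rcases le_total t 0 with ht | ht
      · rwa [hneg t ht]
      · rw [hpos t ht]
        rcases ht.eq_or_lt with rfl | ht'
        · rwa [ha.map_zero]
        · have := ha.strictMono (mem_Ici.2 le_rfl) ht ht'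
          rw [ha.map_zero] at this
          exact hs.trans_lt this
  have hsurj : Function.Surjective e := by
    intro y
    rcases le_total y 0 with hy | hy
    · exact ⟨y, hneg y hy⟩
    · obtain ⟨M, hM0, hM⟩ : ∃ M, 0 ≤ M ∧ y ≤ a M :=
        ((eventually_ge_atTop 0).and (ha.tendsto.eventually_ge_atTop y)).exists
      obtain ⟨s, hs, hsy⟩ := intermediate_value_Icc hM0
        (ha.cont.mono fun s hs => hs.1) (show y ∈ Icc (a 0) (a M) by rw [ha.map_zero]; exact ⟨hy, hM⟩)
      exact ⟨s, (hpos s hs.1).trans hsy⟩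
  let φ := hmono.orderIsoOfSurjective e hsurj
  have hφ : ∀ s, φ s = e s := fun s => rfl
  refine ⟨φ.symm, φ.symm.continuous, φ.symm.monotone, fun s hs => ?_, fun s hs => ?_⟩
  · have h0 : 0 ≤ φ.symm s := by
      rw [OrderIso.le_symm_apply, hφ, hneg 0 le_rfl]
      exact hs
    exact ⟨h0, by rw [← hpos _ h0, ← hφ, φ.apply_symm_apply]⟩
  · rw [← hpos s hs, ← hφ, φ.symm_apply_apply]

theorem continuous_tsum_of_locally_bounded {X : Type*} [TopologicalSpace X] {f : ℕ → X → ℝ}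
    (hf : ∀ j, Continuous (f j))
    (hb : ∀ x, ∃ s ∈ 𝓝 x, ∃ u : ℕ → ℝ, Summable u ∧ ∀ j, ∀ y ∈ s, ‖f j y‖ ≤ u j) :
    Continuous fun x => ∑' j, f j x := by
  rw [continuous_iff_continuousAt]
  intro x
  obtain ⟨s, hs, u, hu, hfu⟩ := hb x
  exact (continuousOn_tsum (fun j => (hf j).continuousOn) hu hfu).continuousAt hs

/-- A continuous nonnegative function vanishing at the origin is bounded by a class `𝒦_∞` function
of the norm. -/
theorem exists_classKInf_upper_bound {E : Type*} [NormedAddCommGroup E] [NormedSpace ℝ E]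
    [ProperSpace E] {V : E → ℝ} (hV : Continuous V) (h0 : V 0 = 0) (hnn : ∀ z, 0 ≤ V z) :
    ∃ p : ℝ → ℝ, IsClassKInf p ∧ ∀ z, V z ≤ p ‖z‖ := by
  have hc : IsCompact (Metric.closedBall (0 : E) 1) := isCompact_closedBall 0 1
  -- The maximum of `V` over the ball of radius `s`, taken over a fixed compact set so that it is
  -- continuous in `s`.
  set h : ℝ → ℝ := fun s => sSup ((fun v => V (s • v)) '' Metric.closedBall (0 : E) 1) with hh
  have hcont : Continuous h :=
    hc.continuous_sSup (f := fun (s : ℝ) (v : E) => V (s • v)) (by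
      exact hV.comp (continuous_fst.smul continuous_snd))
  have hle : ∀ s z, 0 ≤ s → ‖z‖ ≤ s → V z ≤ h s := by
    intro s z hs hz
    rcases hs.eq_or_lt with rfl | hs
    · rw [norm_le_zero_iff.1 hz, h0]
      refine Real.sSup_nonneg ?_
      rintro _ ⟨v, -, rfl⟩
      exact hnn _
    · refine le_csSup (hc.image (hV.comp (continuous_const_smul s))).bddAbove
        ⟨s⁻¹ • z, ?_, ?_⟩
      · rw [mem_closedBall_zero_iff, norm_smul, norm_inv, Real.norm_of_nonneg hs.le,
          inv_mul_le_one₀ hs]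
        exact hz
      · simp [smul_smul, hs.ne']
  have hmono : ∀ s t, 0 ≤ s → s ≤ t → h s ≤ h t := by
    intro s t hs hst
    refine csSup_le ((Metric.nonempty_closedBall.2 zero_le_one).image _) ?_
    rintro _ ⟨v, hv, rfl⟩
    refine hle t _ (hs.trans hst) ?_
    rw [mem_closedBall_zero_iff] at hv
    rw [norm_smul, Real.norm_of_nonneg hs]
    exact (mul_le_of_le_one_right hs hv).trans hst
  have hzero : h 0 = 0 := by
    have : (fun v : E => V ((0 : ℝ) • v)) = fun _ => 0 := by ext v; simp [h0]
    simp only [hh, this]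
    rw [(Metric.nonempty_closedBall.2 zero_le_one).image_const, csSup_singleton]
  refine ⟨fun s => h s + s, ⟨⟨(hcont.add continuous_id).continuousOn, ?_, by simp [hzero]⟩, ?_⟩,
    fun z => ?_⟩
  · exact fun s hs t _ hst => add_lt_add_of_le_of_lt (hmono s t hs hst.le) hst
  · refine tendsto_atTop_mono' _ ?_ tendsto_id
    filter_upwards [eventually_ge_atTop 0] with s hs
    have := hmono 0 s le_rfl hs
    simp only [id]
    linarith
  · have := hle ‖z‖ z (norm_nonneg z) le_rfl
    have := norm_nonneg z
    simp only
    linarith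

/-! ### Gain margin of ISS systems -/

section Robustness

variable {E D : Type*} [NormedAddCommGroup E] [NormedAddCommGroup D]

/-- The ISS estimate depends only on the past of the input. -/
theorem iss_causal {F : E → D → E} {β : ℝ → ℝ → ℝ} {γ : ℝ → ℝ} (hγ : IsClassK γ)
    (hISS : ∀ (d : ℕ → D) (x : ℕ → E), BddAbove (range fun s => ‖d s‖) →
      (∀ t, x (t + 1) = F (x t) (d t)) →
      ∀ t : ℕ, ‖x t‖ ≤ β ‖x 0‖ t + γ (⨆ s, ‖d s‖))
    {d : ℕ → D} {x : ℕ → E} (hx : ∀ t, x (t + 1) = F (x t) (d t)) {t : ℕ} {c : ℝ} (hc : 0 ≤ c)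
    (hd : ∀ s < t, ‖d s‖ ≤ c) : ‖x t‖ ≤ β ‖x 0‖ t + γ c := by
  -- Cutting the input off from time `t` on leaves the state at time `t` unchanged and brings the
  -- supremum below `c`.
  set d' : ℕ → D := fun s => if s < t then d s else 0 with hd'
  let x' : ℕ → E := fun s => Nat.rec (x 0) (fun s y => F y (d' s)) s
  have hx' : ∀ s, x' (s + 1) = F (x' s) (d' s) := fun s => rfl
  have heq : ∀ s ≤ t, x' s = x s := by
    intro s
    induction s with
    | zero => intro _; rfl
    | succ s ih =>
      intro hs
      rw [hx', ih (by omega), hx, hd']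
      simp [show s < t by omega]
  have hbd : ∀ s, ‖d' s‖ ≤ c := by
    intro s
    by_cases hs : s < t
    · simpa [hd', hs] using hd s hs
    · simpa [hd', hs] using hc
  have := hISS d' x' ⟨c, by rintro _ ⟨s, rfl⟩; exact hbd s⟩ hx' t
  rw [heq t le_rfl, heq 0 (Nat.zero_le t)] at this
  refine this.trans (add_le_add_right ?_ _)
  exact hγ.mono (Real.iSup_nonneg fun s => norm_nonneg _) (ciSup_le hbd)

/-- An ISS system tolerates inputs that are small relative to the state: under such inputs the
origin is stable and uniformly attractive. -/
theorem iss_exists_gain_margin {F : E → D → E} {β : ℝ → ℝ → ℝ} {γ : ℝ → ℝ} (hβ : IsClassKL β)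
    (hγ : IsClassK γ)
    (hISS : ∀ (d : ℕ → D) (x : ℕ → E), BddAbove (range fun s => ‖d s‖) →
      (∀ t, x (t + 1) = F (x t) (d t)) →
      ∀ t : ℕ, ‖x t‖ ≤ β ‖x 0‖ t + γ (⨆ s, ‖d s‖)) :
    ∃ g δ : ℝ → ℝ, IsClassKInf g ∧ IsClassKInf δ ∧
      (∀ (d : ℕ → D) (x : ℕ → E), (∀ t, x (t + 1) = F (x t) (d t) ∧ g ‖d t‖ ≤ ‖x t‖) →
        ∀ t, ‖x t‖ ≤ δ ‖x 0‖) ∧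
      ∀ R ε : ℝ, 0 < ε → ∃ T : ℕ, ∀ (d : ℕ → D) (x : ℕ → E),
        (∀ t, x (t + 1) = F (x t) (d t) ∧ g ‖d t‖ ≤ ‖x t‖) → ‖x 0‖ ≤ R →
        ∀ t ≥ T, ‖x t‖ ≤ ε := by
  -- The summand `s` makes both functions invertible. The factor 2 gives `γ (κ s) ≤ s / 2` for the
  -- inverse `κ` of `γ'`, and `β s 0 + s / 2 ≤ δ s`.
  have hδ : IsClassKInf fun s => 2 * (β s 0 + s) :=
    (isClassKInf_const_mul two_pos).comp (hβ.classK 0 le_rfl).add_id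
  have hγ' : IsClassKInf fun s => 2 * (γ s + s) :=
    (isClassKInf_const_mul two_pos).comp hγ.add_id
  have hg := hδ.comp hγ'
  set δ : ℝ → ℝ := fun s => 2 * (β s 0 + s) with hδdef
  set γ' : ℝ → ℝ := fun s => 2 * (γ s + s) with hγdef
  obtain ⟨κ, -, hκmono, hκ, hκ'⟩ := hγ'.exists_inverse
  -- Small-gain induction: the bound by `δ` at earlier times keeps the inputs below `κ ‖x 0‖`, and
  -- causality returns the bound at time `t`.
  have key : ∀ (d : ℕ → D) (x : ℕ → E),
      (∀ t, x (t + 1) = F (x t) (d t) ∧ δ (γ' ‖d t‖) ≤ ‖x t‖) →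
        ∀ t : ℕ, ‖x t‖ ≤ δ ‖x 0‖ ∧ ‖x t‖ ≤ β ‖x 0‖ t + ‖x 0‖ / 2 := by
    intro d x hx t
    induction t using Nat.strong_induction_on with
    | _ t ih =>
      have hd : ∀ s < t, ‖d s‖ ≤ κ ‖x 0‖ := by
        intro s hs
        have h1 : δ (γ' ‖d s‖) ≤ δ ‖x 0‖ := (hx s).2.trans (ih s hs).1
        have h2 : γ' ‖d s‖ ≤ ‖x 0‖ :=
          (hδ.strictMono.le_iff_le (hγ'.nonneg (norm_nonneg _)) (norm_nonneg _)).1 h1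
        rw [← hκ' ‖d s‖ (norm_nonneg _)]
        exact hκmono h2
      obtain ⟨hκ0, hκeq⟩ := hκ ‖x 0‖ (norm_nonneg _)
      have h3 := iss_causal hγ hISS (fun t => (hx t).1) hκ0 hd
      have h4 : ‖x t‖ ≤ β ‖x 0‖ t + ‖x 0‖ / 2 := by
        simp only [hγdef] at hκeq
        linarith
      refine ⟨?_, h4⟩
      have h5 : β ‖x 0‖ t ≤ β ‖x 0‖ 0 := by
        rcases (norm_nonneg (x 0)).eq_or_lt with h0 | h0
        · rw [← h0, (hβ.classK 0 le_rfl).map_zero, (hβ.classK t t.cast_nonneg).map_zero]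
        · exact (hβ.strictAnti _ h0).antitoneOn (mem_Ici.2 le_rfl) (mem_Ici.2 t.cast_nonneg)
            t.cast_nonneg
      have h6 := (hβ.classK 0 le_rfl).nonneg (norm_nonneg (x 0))
      have h7 := norm_nonneg (x 0)
      simp only [hδdef]
      linarith
  refine ⟨_, δ, hg, hδ, fun d x hx t => (key d x hx t).1, ?_⟩
  -- Once `β` has decayed to a quarter of the radius, `1/4 + 1/2 = 3/4` of it remains; restarting
  -- there iterates the contraction.
  have hcontr : ∀ R : ℝ, 0 < R → ∀ k : ℕ, ∃ T : ℕ, ∀ (d : ℕ → D) (x : ℕ → E),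
      (∀ t, x (t + 1) = F (x t) (d t) ∧ δ (γ' ‖d t‖) ≤ ‖x t‖) → ‖x 0‖ ≤ R →
        ∀ t ≥ T, ‖x t‖ ≤ (3 / 4) ^ k * R := by
    intro R hR k
    induction k with
    | zero =>
      obtain ⟨T, hT⟩ : ∃ T : ℕ, ∀ t ≥ T, β R (t : ℝ) ≤ R / 4 :=
        eventually_atTop.1 (((hβ.tendsto R hR).comp tendsto_natCast_atTop_atTop).eventually_le_const
          (by positivity))
      refine ⟨T, fun d x hx hx0 t ht => ?_⟩
      have h1 := (key d x hx t).2
      have h2 := (hβ.classK t t.cast_nonneg).mono (norm_nonneg (x 0)) hx0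
      have h3 := hT t ht
      simp only [pow_zero, one_mul]
      linarith
    | succ k ih =>
      obtain ⟨T₁, hT₁⟩ := ih
      have hR' : 0 < (3 / 4 : ℝ) ^ k * R := by positivity
      set R' := (3 / 4 : ℝ) ^ k * R with hRdef
      obtain ⟨T, hT⟩ : ∃ T : ℕ, ∀ t ≥ T, β R' (t : ℝ) ≤ R' / 4 :=
        eventually_atTop.1 (((hβ.tendsto R' hR').comp
          tendsto_natCast_atTop_atTop).eventually_le_const (by positivity))
      refine ⟨T₁ + T, fun d x hx hx0 t ht => ?_⟩
      obtain ⟨s, rfl⟩ : ∃ s, t = T₁ + s := ⟨t - T₁, by omega⟩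
      have h0 := hT₁ d x hx hx0 T₁ le_rfl
      have h1 := (key (fun i => d (T₁ + i)) (fun i => x (T₁ + i)) (fun i => hx (T₁ + i)) s).2
      have h2 := (hβ.classK s s.cast_nonneg).mono (norm_nonneg (x T₁)) h0
      have h3 := hT s (by omega)
      simp only [add_zero] at h1 h2
      rw [pow_succ, mul_right_comm]
      linarith
  intro R ε hε
  have hR : 0 < max R 1 := lt_max_of_lt_right one_pos
  obtain ⟨k, hk⟩ := exists_pow_lt_of_lt_one (show 0 < ε / max R 1 by positivity)
    (show (3 / 4 : ℝ) < 1 by norm_num)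
  obtain ⟨T, hT⟩ := hcontr _ hR k
  refine ⟨T, fun d x hx hx0 t ht => (hT d x hx (hx0.trans (le_max_left _ _)) t ht).trans ?_⟩
  exact ((lt_div_iff₀ hR).1 hk).le

end Robustness

/-! ### Converse Lyapunov theorem for compact disturbances -/

noncomputable section

/-- The trajectory of `x_{t+1} = G (x_t, v_t)` with initial state `z`. -/
def flow {E U : Type*} (G : E → U → E) (z : E) (v : ℕ → U) : ℕ → E
  | 0 => z
  | t + 1 => G (flow G z v t) (v t)

theorem flow_succ_eq {E U : Type*} (G : E → U → E) (z : E) (v : ℕ → U) (t : ℕ) :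
    flow G z v (t + 1) = flow G (G z (v 0)) (fun i => v (i + 1)) t := by
  induction t with
  | zero => rfl
  | succ t ih =>
    rw [flow, ih]
    rfl

theorem continuous_flow {E U : Type*} [TopologicalSpace E] [TopologicalSpace U] {G : E → U → E}
    (hG : Continuous fun p : E × U => G p.1 p.2) (t : ℕ) :
    Continuous fun p : E × (ℕ → U) => flow G p.1 p.2 t := by
  induction t with
  | zero => exact continuous_fst
  | succ t ih =>
    exact hG.comp (ih.prodMk ((continuous_apply t).comp continuous_snd))

/-- The part of `s` that exceeds `1 / (j + 1)`. -/
def excess (j : ℕ) (s : ℝ) : ℝ := max 0 (s - 1 / ((j : ℝ) + 1))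

theorem excess_nonneg (j : ℕ) (s : ℝ) : 0 ≤ excess j s := le_max_left _ _

theorem continuous_excess (j : ℕ) : Continuous (excess j) := by
  unfold excess
  fun_prop

theorem excess_mono (j : ℕ) : Monotone (excess j) := fun _ _ h =>
  max_le_max le_rfl (sub_le_sub_right h _)

theorem excess_le (j : ℕ) {s : ℝ} (hs : 0 ≤ s) : excess j s ≤ s :=
  max_le hs (sub_le_self _ (by positivity))

theorem excess_eq_zero {j : ℕ} {s : ℝ} (hs : s ≤ 1 / ((j : ℝ) + 1)) : excess j s = 0 :=
  max_eq_left (sub_nonpos.2 hs)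

theorem summable_weighted_excess {c : ℕ → ℝ} (hc : ∀ j, 0 < c j) (hsum : Summable c) {s : ℝ}
    (hs : 0 ≤ s) : Summable fun j => c j * excess j s :=
  (hsum.mul_right s).of_nonneg_of_le (fun j => mul_nonneg (hc j).le (excess_nonneg j s))
    fun j => mul_le_mul_of_nonneg_left (excess_le j hs) (hc j).le

/-- Strict growth at `t > 0` comes from any term with `1 / (j + 1) < t`, unboundedness from the term
`j = 0`. -/
theorem isClassKInf_tsum_excess {c : ℕ → ℝ} (hc : ∀ j, 0 < c j) (hsum : Summable c) :
    IsClassKInf fun s => ∑' j, c j * excess j s where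
  cont := by
    intro s hs
    refine ContinuousOn.mono (s := Icc 0 (s + 1)) ?_ (fun _ h => h) |>.continuousWithinAt
      ⟨hs, by linarith⟩ |>.mono_of_mem_nhdsWithin ?_
    · refine continuousOn_tsum (u := fun j => c j * (s + 1))
        (fun j => (continuous_const.mul (continuous_excess j)).continuousOn)
        (hsum.mul_right _) fun j y hy => ?_
      rw [Real.norm_of_nonneg (mul_nonneg (hc j).le (excess_nonneg j y))]
      exact mul_le_mul_of_nonneg_left ((excess_le j hy.1).trans hy.2) (hc j).le
    · filter_upwards [self_mem_nhdsWithin, mem_nhdsWithin_of_mem_nhds (Iio_mem_nhds (lt_add_one s))]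
        with y hy hy'
      exact ⟨hy, le_of_lt hy'⟩
  strictMono := by
    intro s hs t ht hst
    obtain ⟨j, hj⟩ := exists_nat_one_div_lt (lt_of_le_of_lt hs hst)
    refine Summable.tsum_lt_tsum (i := j)
      (fun i => mul_le_mul_of_nonneg_left (excess_mono i hst.le) (hc i).le) ?_
      (summable_weighted_excess hc hsum hs) (summable_weighted_excess hc hsum ht)
    refine mul_lt_mul_of_pos_left ?_ (hc j)
    have h1 : t - 1 / ((j : ℝ) + 1) ≤ excess j t := le_max_right _ _
    exact max_lt (by linarith) (by linarith)
  map_zero := by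
    have : ∀ j : ℕ, excess j 0 = 0 := fun j => excess_eq_zero (by positivity)
    simp [this]
  tendsto := by
    have h1 : Tendsto (fun s : ℝ => c 0 * (s - 1)) atTop atTop :=
      (tendsto_atTop_add_const_right _ (-1) tendsto_id).const_mul_atTop (hc 0)
    refine tendsto_atTop_mono' _ ?_ h1
    filter_upwards [eventually_ge_atTop 0] with s hs
    have h2 : s - 1 ≤ excess 0 s := by
      rw [excess, Nat.cast_zero, zero_add, div_one]
      exact le_max_right _ _
    exact (mul_le_mul_of_nonneg_left h2 (hc 0).le).trans
      ((summable_weighted_excess hc hsum hs).le_tsum 0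
        fun j _ => mul_nonneg (hc j).le (excess_nonneg j s))

/-- Converse Lyapunov theorem for a system with compactly many disturbance values: uniform stability
and uniform attractivity of the origin yield a continuous strict Lyapunov function. -/
theorem exists_strict_lyapunov {E U : Type*} [NormedAddCommGroup E] [TopologicalSpace U]
    [CompactSpace U] [Nonempty U] {G : E → U → E} (hG : Continuous fun p : E × U => G p.1 p.2)
    {δ : ℝ → ℝ} (hδ : IsClassKInf δ) (hstab : ∀ z v t, ‖flow G z v t‖ ≤ δ ‖z‖)
    (hattr : ∀ R ε : ℝ, 0 < ε → ∃ T : ℕ, ∀ z v, ‖z‖ ≤ R → ∀ t ≥ T, ‖flow G z v t‖ ≤ ε) :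
    ∃ (V : E → ℝ) (α : ℝ → ℝ), Continuous V ∧ IsClassKInf α ∧ V 0 = 0 ∧ (∀ z, α ‖z‖ ≤ V z) ∧
      ∀ z v, V (G z v) ≤ V z - α ‖z‖ := by
  have hT : ∀ j R : ℕ, ∃ T : ℕ, ∀ z v, ‖z‖ ≤ R → ∀ t ≥ T, ‖flow G z v t‖ ≤ 1 / ((j : ℝ) + 1) :=
    fun j R => hattr R _ (by positivity)
  choose T hT using hT
  -- By uniform attractivity only the times before `T j R` contribute, for all initial states in the
  -- ball of radius `R`.
  set P : ℕ → E × (ℕ → U) → ℝ := fun j p => ∑' t, excess j ‖flow G p.1 p.2 t‖ with hP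
  have hzero : ∀ (j R : ℕ) (z : E) (v : ℕ → U), ‖z‖ ≤ R → ∀ t ∉ Finset.range (T j R),
      excess j ‖flow G z v t‖ = 0 := fun j R z v hz t ht =>
    excess_eq_zero (hT j R z v hz t (by simpa using ht))
  have hPsum : ∀ j z (v : ℕ → U), Summable fun t => excess j ‖flow G z v t‖ := by
    intro j z v
    obtain ⟨R, hR⟩ := exists_nat_ge ‖z‖
    exact summable_of_ne_finset_zero (hzero j R z v hR)
  have hPnn : ∀ j p, 0 ≤ P j p := fun j p => tsum_nonneg fun t => excess_nonneg _ _
  have hPle : ∀ (j R : ℕ) (z : E) (v : ℕ → U), ‖z‖ ≤ R → P j (z, v) ≤ T j R * δ ‖z‖ := by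
    intro j R z v hz
    simp only [hP]
    rw [tsum_eq_sum (hzero j R z v hz)]
    refine (Finset.sum_le_card_nsmul _ _ (δ ‖z‖) fun t _ =>
      (excess_le j (norm_nonneg _)).trans (hstab z v t)).trans_eq ?_
    simp
  have hnhds : ∀ p : E × (ℕ → U), ∃ R : ℕ, ∃ s ∈ 𝓝 p, ∀ q ∈ s, ‖q.1‖ ≤ R := by
    intro p
    obtain ⟨R, hR⟩ := exists_nat_gt ‖p.1‖
    exact ⟨R, {q | ‖q.1‖ < R}, (isOpen_lt (by fun_prop) continuous_const).mem_nhds hR,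
      fun q hq => le_of_lt hq⟩
  have hPcont : ∀ j, Continuous (P j) := by
    intro j
    refine continuous_tsum_of_locally_bounded
      (fun t => (continuous_excess j).comp (continuous_flow hG t).norm) fun p => ?_
    obtain ⟨R, s, hs, hsR⟩ := hnhds p
    refine ⟨s, hs, fun t => if t ∈ Finset.range (T j R) then δ R else 0,
      summable_of_ne_finset_zero (s := Finset.range (T j R)) fun t ht => if_neg ht,
      fun t q hq => ?_⟩
    rw [Real.norm_of_nonneg (excess_nonneg _ _)]
    by_cases ht : t ∈ Finset.range (T j R)
    · simp only [ht, if_true]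
      exact ((excess_le j (norm_nonneg _)).trans (hstab q.1 q.2 t)).trans
        (hδ.mono (norm_nonneg _) (hsR q hq))
    · simp only [ht, if_false]
      exact (hzero j R q.1 q.2 (hsR q hq) t ht).le
  -- On the ball of radius `R`, the terms with `j ≥ R` may use the time `T j j`, which the weight
  -- cancels up to a geometric factor; finitely many remain.
  set c : ℕ → ℝ := fun j => (1 / 2 : ℝ) ^ j / (1 + T j j) with hcdef
  have hc : ∀ j, 0 < c j := fun j => by positivity
  have hcsum : Summable c := summable_geometric_two.of_nonneg_of_le (fun j => (hc j).le)
    fun j => div_le_self (by positivity) (by simp)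
  have hbound : ∀ R : ℕ, ∃ u : ℕ → ℝ, Summable u ∧ ∀ j, ∀ q : E × (ℕ → U), ‖q.1‖ ≤ R →
      ‖c j * P j q‖ ≤ u j := by
    intro R
    have hδR : 0 ≤ δ R := hδ.nonneg R.cast_nonneg
    refine ⟨fun j => (1 / 2 : ℝ) ^ j * δ R +
        if j ∈ Finset.range R then c j * (T j R * δ R) else 0,
      (summable_geometric_two.mul_right _).add
        (summable_of_ne_finset_zero (s := Finset.range R) fun t ht => if_neg ht),
      fun j q hq => ?_⟩
    rw [Real.norm_of_nonneg (mul_nonneg (hc j).le (hPnn j q))]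
    have hδq : δ ‖q.1‖ ≤ δ R := hδ.mono (norm_nonneg _) hq
    by_cases hj : j ∈ Finset.range R
    · simp only [hj, if_true]
      refine le_add_of_nonneg_of_le (by positivity) (mul_le_mul_of_nonneg_left ?_ (hc j).le)
      exact (hPle j R q.1 q.2 hq).trans (mul_le_mul_of_nonneg_left hδq (Nat.cast_nonneg _))
    · simp only [hj, if_false, add_zero]
      have hRj : (R : ℝ) ≤ j := by exact_mod_cast (by simpa using hj : R ≤ j)
      have h1 : P j q ≤ (1 + T j j) * δ R :=
        (hPle j j q.1 q.2 (hq.trans hRj)).trans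
          (mul_le_mul (by linarith) hδq (hδ.nonneg (norm_nonneg _)) (by positivity))
      calc c j * P j q ≤ c j * ((1 + T j j) * δ R) := mul_le_mul_of_nonneg_left h1 (hc j).le
        _ = (1 / 2 : ℝ) ^ j * δ R := by
          simp only [hcdef]
          field_simp
  set S : E × (ℕ → U) → ℝ := fun p => ∑' j, c j * P j p with hS
  have hSnn : ∀ p, 0 ≤ S p := fun p => tsum_nonneg fun j => mul_nonneg (hc j).le (hPnn j p)
  have hScont : Continuous S := by
    refine continuous_tsum_of_locally_bounded (fun j => continuous_const.mul (hPcont j))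
      fun p => ?_
    obtain ⟨R, s, hs, hsR⟩ := hnhds p
    obtain ⟨u, hu, hle⟩ := hbound R
    exact ⟨s, hs, u, hu, fun j q hq => hle j q (hsR q hq)⟩
  have hSsum : ∀ p, Summable fun j => c j * P j p := by
    intro p
    obtain ⟨R, hR⟩ := exists_nat_ge ‖p.1‖
    obtain ⟨u, hu, hle⟩ := hbound R
    exact hu.of_norm_bounded fun j => hle j p hR
  set α : ℝ → ℝ := fun s => ∑' j, c j * excess j s with hα
  have hαK : IsClassKInf α := isClassKInf_tsum_excess hc hcsum
  -- `S` is the total of `α ‖x_t‖` over the trajectory; the time-zero term splits off.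
  have hSstep : ∀ z (v : ℕ → U), S (z, v) = α ‖z‖ + S (G z (v 0), fun i => v (i + 1)) := by
    intro z v
    simp only [hS, hα]
    rw [← (summable_weighted_excess hc hcsum (norm_nonneg z)).tsum_add (hSsum _)]
    congr 1
    ext j
    rw [← mul_add]
    congr 1
    simp only [hP]
    rw [(hPsum j z v).tsum_eq_zero_add]
    simp only [flow_succ_eq]
    rfl
  have hbdd : ∀ z, BddAbove ((fun v => S (z, v)) '' univ) := fun z =>
    (isCompact_univ.image (hScont.comp (Continuous.prodMk_right z))).bddAbove
  have hne : ∀ z, ((fun v => S (z, v)) '' univ).Nonempty := fun z => univ_nonempty.image _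
  -- Disturbance sequences form a compact space by Tychonoff, so the supremum over them is
  -- continuous.
  refine ⟨fun z => sSup ((fun v => S (z, v)) '' univ), α,
    isCompact_univ.continuous_sSup (f := fun z v => S (z, v)) hScont, hαK, ?_, ?_, ?_⟩
  · have h0 : ∀ v : ℕ → U, S (0, v) = 0 := by
      intro v
      have : ∀ j, P j (0, v) = 0 := fun j =>
        le_antisymm ((hPle j 0 0 v (by simp)).trans_eq (by simp [hδ.map_zero])) (hPnn _ _)
      simp [hS, this]
    simp [h0]
  · intro z
    obtain ⟨v⟩ : Nonempty (ℕ → U) := inferInstance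
    refine le_trans ?_ (le_csSup (hbdd z) ⟨v, mem_univ v, rfl⟩)
    simp only
    rw [hSstep z v]
    exact le_add_of_nonneg_right (hSnn _)
  · intro z u
    refine csSup_le (hne _) ?_
    rintro _ ⟨v, -, rfl⟩
    -- Dynamic programming: `u` followed by `v` competes in the supremum at `z`.
    have h1 := le_csSup (hbdd z) ⟨fun i => Nat.casesOn i u v, mem_univ _, rfl⟩
    simp only at h1
    rw [hSstep] at h1
    change α ‖z‖ + S (G z u, v) ≤ _ at h1
    simp only
    linarith

end

/-! ### From the gain margin to the dissipation inequality -/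

/-- Converse ISS Lyapunov theorem for Lipschitz systems. -/
theorem exists_iss_lyapunov {E D : Type*} [NormedAddCommGroup E] [NormedSpace ℝ E] [ProperSpace E]
    [NormedAddCommGroup D] [NormedSpace ℝ D] [ProperSpace D] {F : E → D → E} {L : NNReal}
    (hF : LipschitzWith L fun p : E × D => F p.1 p.2) (hF0 : F 0 0 = 0)
    {β : ℝ → ℝ → ℝ} {γ : ℝ → ℝ} (hβ : IsClassKL β) (hγ : IsClassK γ)
    (hISS : ∀ (d : ℕ → D) (x : ℕ → E), BddAbove (range fun s => ‖d s‖) →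
      (∀ t, x (t + 1) = F (x t) (d t)) →
      ∀ t : ℕ, ‖x t‖ ≤ β ‖x 0‖ t + γ (⨆ s, ‖d s‖)) :
    ∃ (V : E → ℝ) (plow pbar q σ : ℝ → ℝ), Continuous V ∧
      IsClassKInf plow ∧ IsClassKInf pbar ∧ IsClassKInf q ∧ IsClassK σ ∧
      (∀ z, plow ‖z‖ ≤ V z ∧ V z ≤ pbar ‖z‖) ∧
      ∀ z d, V (F z d) - V z ≤ -q ‖z‖ + σ ‖d‖ := by
  obtain ⟨g, δ, hg, hδ, hstab, hattr⟩ := iss_exists_gain_margin hβ hγ hISS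
  obtain ⟨ρ, hρcont, hρmono, hρ, hρ'⟩ := hg.exists_inverse
  have : CompactSpace (Metric.closedBall (0 : D) 1) :=
    isCompact_iff_compactSpace.1 (isCompact_closedBall 0 1)
  have : Nonempty (Metric.closedBall (0 : D) 1) := ⟨⟨0, by simp⟩⟩
  let G : E → Metric.closedBall (0 : D) 1 → E := fun z u => F z (ρ ‖z‖ • (u : D))
  have hG : Continuous fun p : E × Metric.closedBall (0 : D) 1 => G p.1 p.2 :=
    hF.continuous.comp (continuous_fst.prodMk
      ((hρcont.comp continuous_fst.norm).smul (continuous_subtype_val.comp continuous_snd)))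
  have htraj : ∀ z (v : ℕ → Metric.closedBall (0 : D) 1) t,
      flow G z v (t + 1) = F (flow G z v t) (ρ ‖flow G z v t‖ • (v t : D)) ∧
        g ‖ρ ‖flow G z v t‖ • (v t : D)‖ ≤ ‖flow G z v t‖ := by
    intro z v t
    refine ⟨rfl, ?_⟩
    obtain ⟨h1, h2⟩ := hρ _ (norm_nonneg (flow G z v t))
    refine (hg.mono (norm_nonneg _) ?_).trans_eq h2
    rw [norm_smul, Real.norm_of_nonneg h1]
    exact mul_le_of_le_one_right h1 (mem_closedBall_zero_iff.1 (v t).2)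
  obtain ⟨V, α, hV, hα, hV0, hαV, hdec⟩ := exists_strict_lyapunov hG hδ
    (fun z v t => hstab _ _ (htraj z v) t) (fun R ε hε => by
      obtain ⟨T, hT⟩ := hattr R ε hε
      exact ⟨T, fun z v hz t ht => hT _ _ (htraj z v) hz t ht⟩)
  have hVnn : ∀ z, 0 ≤ V z := fun z => (hα.nonneg (norm_nonneg z)).trans (hαV z)
  obtain ⟨p, hp, hVp⟩ := exists_classKInf_upper_bound hV hV0 hVnn
  have hL : (0 : ℝ) < L + 1 := by positivity
  -- Needed only when `‖z‖ < g ‖d‖`: then `‖F z d‖ ≤ (L + 1) * (g ‖d‖ + ‖d‖)`. The `+ 1` keeps the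
  -- factor positive.
  have hσ : IsClassKInf fun s => p ((L + 1) * (g s + s)) :=
    hp.comp ((isClassKInf_const_mul hL).comp hg.add_id)
  refine ⟨V, α, p, α, _, hV, hα, hp, hα, hσ.toIsClassK, fun z => ⟨hαV z, hVp z⟩, fun z d => ?_⟩
  have hσd := hσ.nonneg (norm_nonneg d)
  rcases le_or_gt (g ‖d‖) ‖z‖ with hd | hd
  · have hdρ : ‖d‖ ≤ ρ ‖z‖ := by
      rw [← hρ' ‖d‖ (norm_nonneg d)]
      exact hρmono hd
    obtain ⟨u, hu⟩ : ∃ u : Metric.closedBall (0 : D) 1, ρ ‖z‖ • (u : D) = d := by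
      rcases (hρ _ (norm_nonneg z)).1.eq_or_lt with h0 | h0
      · refine ⟨⟨0, by simp⟩, ?_⟩
        rw [← h0, norm_le_zero_iff] at hdρ
        simp [hdρ]
      · refine ⟨⟨(ρ ‖z‖)⁻¹ • d, ?_⟩, by simp [smul_smul, h0.ne']⟩
        rw [mem_closedBall_zero_iff, norm_smul, norm_inv, Real.norm_of_nonneg h0.le,
          inv_mul_le_one₀ h0]
        exact hdρ
    have h1 : V (F z d) ≤ V z - α ‖z‖ := by
      rw [← hu]
      exact hdec z u
    linarith
  · have h1 : ‖F z d‖ ≤ L * ‖(z, d)‖ := by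
      have := hF.norm_sub_le (z, d) (0, 0)
      simpa [hF0] using this
    have h2 : ‖(z, d)‖ ≤ g ‖d‖ + ‖d‖ :=
      max_le (hd.le.trans (le_add_of_nonneg_right (norm_nonneg d)))
        (le_add_of_nonneg_left (hg.nonneg (norm_nonneg d)))
    have h3 : ‖F z d‖ ≤ (L + 1) * (g ‖d‖ + ‖d‖) :=
      h1.trans (mul_le_mul (by linarith) h2 (norm_nonneg _) hL.le)
    have h4 := (hVp (F z d)).trans (hp.mono (norm_nonneg _) h3)
    have h5 := hαV z
    linarith

/-! ### Exploration mode of the closed loop -/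

theorem controllerStep_zero {m : ℕ} (K : Matrix (Fin m) (Fin m) ℝ) {αmin : ℝ} (hα : 0 < αmin)
    (θhat r : Vec m) : controllerStep K αmin 0 θhat r = r := by
  simp [controllerStep, not_le.2 hα]

/-- At the optimal equilibrium the reference and the output coincide, by tracking. -/
theorem PlantAssumption.output_eq {n m : ℕ} {f : Vec n → Vec m → Vec n} {g : Vec n → Vec m → Vec m}
    {π : Vec m → Vec n} (hplant : PlantAssumption f g π) {y u : Vec m} {x : Vec n}
    (hx : x = f x u) (hy : y = g x u) : y = u := by
  have := hplant.tracking u (fun _ => x) fun _ => hx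
  rw [← hy] at this
  exact tendsto_nhds_unique tendsto_const_nhds this

theorem mainTheorem8 {n m : ℕ} (f : Vec n → Vec m → Vec n) (g : Vec n → Vec m → Vec m)
    (π : Vec m → Vec n) (J : Vec m → ℝ) (Hlow Hbar K : Matrix (Fin m) (Fin m) ℝ) (γ αmin : ℝ)
    (ystar rstar : Vec m) (xstar : Vec n)
    (hplant : PlantAssumption f g π)
    (hopt : IsOptimalEquilibrium f g J ystar rstar xstar)
    (hcost : CostAssumption J Hlow Hbar ystar)
    (hK : GainCondition K Hbar γ)
    (hαmin : 0 < αmin) :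
    -- the plant is input-to-state stable with respect to the dither in exploration mode
    (∀ rbar : Vec m,
      -- Lyapunov form
      (∃ (Vx : Vec n → ℝ) (plow pbar q σ : ℝ → ℝ), Continuous Vx ∧
        IsClassKInf plow ∧ IsClassKInf pbar ∧ IsClassKInf q ∧ IsClassK σ ∧
        (∀ z, plow ‖z‖ ≤ Vx z ∧ Vx z ≤ pbar ‖z‖) ∧
        ∀ (x : ℕ → Vec n) (r d θhat : ℕ → Vec m) (Θ : ℕ → Set (Vec m)),
          IsClosedLoop f K αmin x r d θhat Θ →
          ∀ t : ℕ, r t = rbar → stepSize K (θhat t) (Θ t) = 0 →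
            Vx (x (t + 1) - π (r (t + 1))) - Vx (x t - π (r t))
              ≤ -q ‖x t - π (r t)‖ + σ ‖d t‖) ∧
      -- trajectory form, for as long as the exploration mode lasts
      (∃ (β : ℝ → ℝ → ℝ) (ρ : ℝ → ℝ), IsClassKL β ∧ IsClassK ρ ∧
        ∀ (x : ℕ → Vec n) (r d θhat : ℕ → Vec m) (Θ : ℕ → Set (Vec m)),
          IsClosedLoop f K αmin x r d θhat Θ → r 0 = rbar →
          BddAbove (Set.range fun s => ‖d s‖) →
          ∀ t : ℕ, (∀ s < t, stepSize K (θhat s) (Θ s) = 0) →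
            ‖x t - π (r t)‖ ≤ β ‖x 0 - π (r 0)‖ t + ρ (⨆ s, ‖d s‖))) ∧
    -- the controller is stable: its Lyapunov function is positive definite, radially unbounded
    -- and constant in exploration mode
    (∃ κ₁ κ₂ : ℝ → ℝ, IsClassKInf κ₁ ∧ IsClassKInf κ₂ ∧
      ∀ z, κ₁ ‖z‖ ≤ controllerLyapunov J rstar z ∧ controllerLyapunov J rstar z ≤ κ₂ ‖z‖) ∧
    (∀ (x : ℕ → Vec n) (r d θhat : ℕ → Vec m) (Θ : ℕ → Set (Vec m)),
      IsClosedLoop f K αmin x r d θhat Θ →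
      ∀ t : ℕ, stepSize K (θhat t) (Θ t) = 0 →
        controllerLyapunov J rstar (r (t + 1) - rstar)
          - controllerLyapunov J rstar (r t - rstar) = 0) := by
  refine ⟨fun rbar => ⟨?_, ?_⟩, ?_, ?_⟩
  · obtain ⟨β, ρ, hβ, hρ, hISS⟩ := hplant.iss rbar
    obtain ⟨L, hL⟩ := hplant.lipschitz_f
    have hF : LipschitzWith L fun p : Vec n × Vec m => f (p.1 + π rbar) (rbar + p.2) - π rbar := by
      refine lipschitzWith_iff_norm_sub_le.2 fun p q => ?_
      rw [sub_sub_sub_cancel_right]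
      refine (hL.norm_sub_le (p.1 + π rbar, rbar + p.2) (q.1 + π rbar, rbar + q.2)).trans_eq ?_
      congr 2
      ext1 <;> simp
    obtain ⟨V, plow, pbar, q, σ, hV, hplow, hpbar, hq, hσ, hbd, hdec⟩ :=
      exists_iss_lyapunov (F := fun z d => f (z + π rbar) (rbar + d) - π rbar) hF
        (by simp [(hplant.equilibrium rbar (π rbar)).2 rfl]) hβ hρ (by
          intro d x hd hx t
          have := hISS d (fun t => x t + π rbar) hd (fun t => by simp [hx t]) t
          simpa using this)
    refine ⟨V, plow, pbar, q, σ, hV, hplow, hpbar, hq, hσ, hbd, ?_⟩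
    intro x r d θhat Θ hcl t hrt hst
    have hr : r (t + 1) = rbar := by rw [hcl.controller, hst, controllerStep_zero K hαmin, hrt]
    rw [hr, hrt, hcl.plant t]
    simpa [hrt] using hdec (x t - π rbar) (d t)
  · obtain ⟨β, ρ, hβ, hρ, hISS⟩ := hplant.iss rbar
    refine ⟨β, ρ, hβ, hρ, ?_⟩
    intro x r d θhat Θ hcl hr0 hd t hst
    have hr : ∀ s ≤ t, r s = rbar := by
      intro s
      induction s with
      | zero => exact fun _ => hr0
      | succ s ih =>
        intro hs
        rw [hcl.controller, hst s hs, controllerStep_zero K hαmin, ih (by omega)]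
    -- The ISS estimate needs a trajectory for all time, but the reference may move from time `t`
    -- on; `x'` keeps it frozen and agrees with `x` up to `t`.
    let x' : ℕ → Vec n := fun s => Nat.rec (x 0) (fun s y => f y (rbar + d s)) s
    have hx' : ∀ s ≤ t, x' s = x s := by
      intro s
      induction s with
      | zero => exact fun _ => rfl
      | succ s ih =>
        intro hs
        change f (x' s) (rbar + d s) = _
        rw [ih (by omega), hcl.plant s]
        simp only [hr s (by omega)]
    rw [hr t le_rfl, hr0, ← hx' t le_rfl, ← hx' 0 t.zero_le]
    exact hISS d x' hd (fun s => rfl) t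
  · have hyr : ystar = rstar := hplant.output_eq hopt.state hopt.output
    subst hyr
    obtain ⟨κ₁, κ₂, hκ₁, hκ₂, hκ⟩ := hcost.cost_bounds
    have hJ : J ystar = 0 := by
      have := hκ ystar
      rw [sub_self, norm_zero, hκ₁.map_zero, hκ₂.map_zero] at this
      exact le_antisymm this.2 this.1
    refine ⟨κ₁, κ₂, hκ₁, hκ₂, fun z => ?_⟩
    simpa [controllerLyapunov, hJ] using hκ (z + ystar)
  · intro x r d θhat Θ hcl t hst
    rw [hcl.controller, hst, controllerStep_zero K hαmin, sub_self]
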